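/- Let $R$ be a finite ring, let $M_1,\dots,M_n$ be pairwise non-isomorphic indecomposable finite $R$-modules, let $\mathcal C=\langle M_1,\dots,M_n\rangle$ be the full subcategory of $R$-modules isomorphic to some $\bigoplus_i M_i^{b_i}$ ($b_i\ge 0$), and let $M\cong\bigoplus_i M_i^{a_i}$ be an object of $\mathcal C$. Let $\mathcal C_{+1}$ be the category of additive functors from $\mathcal C$ to finite abelian groups. For $G,F\in\mathcal C_{+1}$ write $G\prec F$ if $G$ is isomorphic to a subquotient of $F$ but not to $F$ itself. Let $K$ be a field of characteristic zero. For $F\in\mathcal C_{+1}$ let $KF(M)$ be the $K$-vector space with basis $\{u_v\}_{v\in F(M)}$, on which $\mathrm{Aut}_R(M)$ and $\mathrm{Aut}_{\mathcal C_{+1}}(F)$ act by permuting the basis. Let $\overline{KF(M)}\subseteq KF(M)$ be the largest $\mathrm{Aut}_R(M)$-subrepresentation with $\mathrm{Hom}_{\mathrm{Aut}_R(M)}(\overline{KF(M)},KG(M))=0$ for every $G\prec F$; it is stable under $\mathrm{Aut}_{\mathcal C_{+1}}(F)$. A morphism $f:X\to Y$ in $\mathcal C$ is a minimal presentation of $F$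 if there is an exact sequence $$\mathrm{Hom}_R(Y,-)\xrightarrow{f^*}\mathrm{Hom}_R(X,-)\xrightarrow{p} F\to 0$$ in $\mathcal C_{+1}$ that begins a minimal projective resolution of $F$, i.e. $p$ is a projective cover of $F$ and $f^*$ is a projective cover of $\ker p$. Assume that $F\in\mathcal C_{+1}$ has a minimal presentation $(X\xrightarrow{f}Y)$ and that $X$ is not (isomorphic to) a direct summand of $M$. Then $\overline{KF(M)}=0$. Consequently $F$ does not arise in functor morphing from $\mathrm{Aut}_R(M)$, that is: 1. there is no irreducible representation $V$ of $\mathrm{Aut}_R(M)$ over $K$ such that $\mathrm{Hom}_{\mathrm{Aut}_R(M)}(KF(M),V)\ne 0$ and $\mathrm{Hom}_{\mathrm{Aut}_R(M)}(KG(M),V)=0$ for every $G\prec F$; 2. there are no irreducible representation $V$ of $\mathrm{Aut}_R(M)$ and representation $U$ of $\mathrm{Aut}_{\mathcal C_{+1}}(F)$ over $K$ such that $(F,U)$ is the functor morphing of $(M,V)$, meaning that $\mathrm{Hom}_{\mathrm{Aut}_R(M)}(V,\overline{KF(M)})\neq 0$ and $U$ is isomorphic to the dual of this $\mathrm{Aut}_{\mathcal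 C_{+1}}(F)$-representation. -/

import Mathlib

open CategoryTheory

universe w v u

namespace FunctorMorphing

/-! ### The category `𝒞₊₁` of additive functors from `𝒞` to finite abelian groups -/

section Functors

variable (C : Type u) [Category.{v} C] [Preadditive C]

/-- The category `𝒞₊₁` of additive functors from `𝒞` to finite abelian groups; the morphisms are
all natural transformations. -/
abbrev FinFun : Type _ :=
  ObjectProperty.FullSubcategory
    (fun F : C ⥤ AddCommGrpCat.{v} => F.Additive ∧ ∀ N : C, Finite (F.obj N))

variable {C}

/-- A natural transformation is a monomorphism of functors: every component is injective. -/
def IsInj {F G : FinFun C} (t : F ⟶ G) : Prop :=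
  ∀ N : C, Function.Injective (t.hom.app N)

/-- A natural transformation is an epimorphism of functors: every component is surjective. -/
def IsSurj {F G : FinFun C} (t : F ⟶ G) : Prop :=
  ∀ N : C, Function.Surjective (t.hom.app N)

/-- `G ≼ F`: `G` is isomorphic to a subquotient of `F`, i.e. to a quotient of a subfunctor `H`. -/
def Subquot (G F : FinFun C) : Prop :=
  ∃ (H : FinFun C) (i : H ⟶ F) (q : H ⟶ G), IsInj i ∧ IsSurj q

/-- `G ≺ F`: `G` is isomorphic to a subquotient of `F`, and is not isomorphic to `F`. -/
def StrictSubquot (G F : FinFun C) : Prop :=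
  Subquot G F ∧ ¬ Nonempty (G ≅ F)

/-- The functor `Hom(X, -)` as an object of `𝒞₊₁`, for `𝒞` with finite hom-groups. -/
def homFun [∀ X Y : C, Finite (X ⟶ Y)] (X : C) : FinFun C where
  obj := preadditiveCoyoneda.obj (Opposite.op X)
  property := ⟨inferInstance, fun N => inferInstanceAs (Finite (X ⟶ N))⟩

/-- The morphism `f^* : Hom(Y, -) ⟶ Hom(X, -)` of precomposition with `f : X ⟶ Y`. -/
def homFunMap [∀ X Y : C, Finite (X ⟶ Y)] {X Y : C} (f : X ⟶ Y) : homFun Y ⟶ homFun X :=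
  ObjectProperty.homMk (preadditiveCoyoneda.map f.op)

/-- `(f : X ⟶ Y)` is a minimal presentation of `F`: there is an exact sequence
`Hom(Y, -) ⟶ Hom(X, -) ⟶ F ⟶ 0`, with maps `f^*` and `p`, that begins a minimal projective
resolution of `F`; that is, `p` is a projective cover of `F`, and `f^*` is a projective cover of
`Ker p`. Since representable functors are projective in `𝒞₊₁` (Yoneda), being a projective cover
means being an essential epimorphism: a morphism into the source whose composite with the
epimorphism is still an epimorphism is itself an epimorphism. -/
def IsMinimalPresentation [∀ X Y : C, Finite (X ⟶ Y)] {X Y : C} (f : X ⟶ Y) (F : FinFun C) :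
    Prop :=
  ∃ p : homFun X ⟶ F,
    IsSurj p ∧
    (∀ (N : C) (φ : X ⟶ N), p.hom.app N φ = 0 ↔ ∃ ρ : Y ⟶ N, f ≫ ρ = φ) ∧
    (∀ (Q : FinFun C) (h : Q ⟶ homFun X), IsSurj (h ≫ p) → IsSurj h) ∧
    (∀ (Q : FinFun C) (h : Q ⟶ homFun Y),
      (∀ (N : C) (φ : X ⟶ N), p.hom.app N φ = 0 →
        ∃ x : Q.obj.obj N, (h ≫ homFunMap f).hom.app N x = φ) →
      IsSurj h)

end Functors

/-! ### The representations `KF(M)` and `\overline{KF(M)}` -/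

section Representations

variable (K : Type w) [Field K] {C : Type u} [Category.{v} C] [Preadditive C]

/-- The permutation representation `KF(M)` of `Aut(M)`, with basis `u_v`, `v ∈ F(M)`, and action
`g • u_v = u_{F(g)(v)}`. -/
noncomputable def KF (F : FinFun C) (M : C) :
    Representation K (Aut M) (F.obj.obj M →₀ K) where
  toFun g := Finsupp.lmapDomain K K (F.obj.map g.hom)
  map_one' := by
    ext v : 2
    simp [show (1 : Aut M) = Iso.refl M from rfl]
  map_mul' g h := by
    ext v : 2
    simp [show (g * h).hom = h.hom ≫ g.hom from rfl]

/-- The homomorphism `KF(M) ⟶ KG(M)`, `u_v ↦ u_{t_M(v)}`, induced by a morphism `t : F ⟶ G`. -/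
noncomputable def kfMap {F G : FinFun C} (t : F ⟶ G) (M : C) :
    Representation.IntertwiningMap (KF K F M) (KF K G M) where
  toLinearMap := Finsupp.lmapDomain K K (t.hom.app M)
  isIntertwining' g := by
    ext v : 2
    simp [KF]

theorem kfMap_id (F : FinFun C) (M : C) (x : F.obj.obj M →₀ K) : kfMap K (𝟙 F) M x = x := by
  change Finsupp.mapDomain (fun v => v) x = x
  exact Finsupp.mapDomain_id

theorem kfMap_comp {F G H : FinFun C} (s : F ⟶ G) (t : G ⟶ H) (M : C)
    (x : F.obj.obj M →₀ K) : kfMap K (s ≫ t) M x = kfMap K t M (kfMap K s M x) := by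
  change Finsupp.mapDomain (fun v => t.hom.app M (s.hom.app M v)) x =
    Finsupp.mapDomain (t.hom.app M) (Finsupp.mapDomain (s.hom.app M) x)
  rw [← Finsupp.mapDomain_comp]
  rfl

/-- A subrepresentation `W` of `KF(M)` satisfies `Hom(W, KG(M)) = 0` for every `G ≺ F`. -/
def KilledBelow {F : FinFun C} {M : C} (W : Subrepresentation (KF K F M)) : Prop :=
  ∀ G : FinFun C, StrictSubquot G F →
    ∀ φ : Representation.IntertwiningMap W.toRepresentation (KF K G M), φ = 0

/-- `\overline{KF(M)}`: the largest subrepresentation `W` of `KF(M)` such that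
`Hom(W, KG(M)) = 0` for every `G ≺ F`. It is built as the sum of all of these; see
`isGreatest_kfBar`. -/
noncomputable def kfBar (F : FinFun C) (M : C) : Subrepresentation (KF K F M) where
  toSubmodule := ⨆ W : {W : Subrepresentation (KF K F M) // KilledBelow K W}, W.1.toSubmodule
  apply_mem_toSubmodule g v hv := by
    have hle : (⨆ W : {W : Subrepresentation (KF K F M) // KilledBelow K W}, W.1.toSubmodule) ≤
        Submodule.comap (KF K F M g)
          (⨆ W : {W : Subrepresentation (KF K F M) // KilledBelow K W}, W.1.toSubmodule) := by
      refine iSup_le fun W x hx => ?_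
      exact (le_iSup (fun W : {W : Subrepresentation (KF K F M) // KilledBelow K W} =>
        W.1.toSubmodule) W) (W.1.apply_mem_toSubmodule g hx)
    exact hle hv

theorem le_kfBar {F : FinFun C} {M : C} {W : Subrepresentation (KF K F M)}
    (hW : KilledBelow K W) : W ≤ kfBar K F M :=
  le_iSup (fun W : {W : Subrepresentation (KF K F M) // KilledBelow K W} =>
    W.1.toSubmodule) ⟨W, hW⟩

theorem killedBelow_kfBar (F : FinFun C) (M : C) : KilledBelow K (kfBar K F M) := by
  intro G hG φ
  have key : ∀ x (hx : x ∈ (kfBar K F M).toSubmodule), φ ⟨x, hx⟩ = 0 := by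
    intro x hx
    have hle : (kfBar K F M).toSubmodule ≤
        (LinearMap.ker φ.toLinearMap).map (kfBar K F M).toSubmodule.subtype := by
      refine iSup_le fun W y hy => ?_
      have hWle : W.1.toSubmodule ≤ (kfBar K F M).toSubmodule := le_kfBar K W.2
      let ψ : Representation.IntertwiningMap W.1.toRepresentation (KF K G M) :=
        { toLinearMap := φ.toLinearMap ∘ₗ Submodule.inclusion hWle
          isIntertwining' := fun g => by
            ext1 z
            exact LinearMap.congr_fun (φ.isIntertwining' g) (Submodule.inclusion hWle z) }
      have hψ : ψ ⟨y, hy⟩ = 0 := by rw [W.2 G hG ψ]; rfl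
      exact ⟨⟨y, hWle hy⟩, hψ, rfl⟩
    obtain ⟨z, hz, rfl⟩ := hle hx
    exact hz
  ext1
  ext1 x
  exact key x.1 x.2

theorem isGreatest_kfBar (F : FinFun C) (M : C) :
    IsGreatest {W : Subrepresentation (KF K F M) | KilledBelow K W} (kfBar K F M) :=
  ⟨killedBelow_kfBar K F M, fun _ hW => le_kfBar K hW⟩

/-- `\overline{KF(M)}` is stable under `Aut(F)`. -/
theorem kfMap_mem_kfBar {F : FinFun C} {M : C} (α : Aut F) {x : F.obj.obj M →₀ K}
    (hx : x ∈ (kfBar K F M).toSubmodule) :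
    kfMap K α.hom M x ∈ (kfBar K F M).toSubmodule := by
  let W : Subrepresentation (KF K F M) :=
    { toSubmodule := (kfBar K F M).toSubmodule.map (kfMap K α.hom M).toLinearMap
      apply_mem_toSubmodule := by
        rintro g _ ⟨y, hy, rfl⟩
        exact ⟨KF K F M g y, (kfBar K F M).apply_mem_toSubmodule g hy,
          (LinearMap.congr_fun ((kfMap K α.hom M).isIntertwining' g) y)⟩ }
  have hW : KilledBelow K W := by
    intro G hG φ
    let ψ : Representation.IntertwiningMap (kfBar K F M).toRepresentation (KF K G M) :=
      { toLinearMap := φ.toLinearMap ∘ₗ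
          (kfMap K α.hom M).toLinearMap.submoduleMap (kfBar K F M).toSubmodule
        isIntertwining' := fun g => by
          ext1 z
          refine Eq.trans (congrArg φ (Subtype.ext ?_)) (LinearMap.congr_fun (φ.isIntertwining' g)
            ((kfMap K α.hom M).toLinearMap.submoduleMap (kfBar K F M).toSubmodule z))
          exact LinearMap.congr_fun ((kfMap K α.hom M).isIntertwining' g) z.1 }
    have hψ := killedBelow_kfBar K F M G hG ψ
    ext1
    ext1 ⟨_, y, hy, rfl⟩
    have : ψ ⟨y, hy⟩ = 0 := by rw [hψ]; rfl
    exact this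
  exact le_kfBar K hW ⟨x, hx, rfl⟩

/-- The action of `Aut(F)` on `\overline{KF(M)}`, `α • u_v = u_{α_M(v)}`, by endomorphisms of the
`Aut(M)`-representation. -/
noncomputable def autBar (F : FinFun C) (M : C) (α : Aut F) :
    Representation.IntertwiningMap (kfBar K F M).toRepresentation
      (kfBar K F M).toRepresentation where
  toLinearMap := (kfMap K α.hom M).toLinearMap.restrict fun _ hx => kfMap_mem_kfBar K α hx
  isIntertwining' g := by
    ext1 z
    exact Subtype.ext (LinearMap.congr_fun ((kfMap K α.hom M).isIntertwining' g) z.1)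

/-! ### Functor morphing -/

section Morphing

variable {V : Type*} [AddCommGroup V] [Module K V] {M : C} (σ : Representation K (Aut M) V)

/-- The multiplicity space `Hom_{Aut(M)}(V, \overline{KF(M)})` of `V` in `\overline{KF(M)}`, as a
representation of `Aut(F)`. -/
noncomputable def multRep (F : FinFun C) :
    Representation K (Aut F)
      (Representation.IntertwiningMap σ (kfBar K F M).toRepresentation) where
  toFun α := Representation.IntertwiningMap.llcomp σ _ _ (autBar K F M α)
  map_one' := by
    ext φ v : 3
    exact Subtype.ext (kfMap_id K F M _)
  map_mul' α β := by
    ext φ v : 3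
    exact Subtype.ext (kfMap_comp K β.hom α.hom M _)

/-- `F` is the functor attached to `V` by functor morphing: `Hom(KF(M), V) ≠ 0`, and
`Hom(KG(M), V) = 0` for every `G ≺ F`. -/
def IsMorphingFunctor (F : FinFun C) : Prop :=
  (∃ φ : Representation.IntertwiningMap (KF K F M) σ, φ ≠ 0) ∧
    ∀ G : FinFun C, StrictSubquot G F →
      ∀ φ : Representation.IntertwiningMap (KF K G M) σ, φ = 0

/-- `(F, U)` is the functor morphing of `(M, V)`: the irreducible representation `V` of `Aut(M)`
occurs in `\overline{KF(M)}`, and `U` is isomorphic to the dual of its multiplicity space. -/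
def IsFunctorMorphing (F : FinFun C) {U : Type*} [AddCommGroup U] [Module K U]
    (τ : Representation K (Aut F) U) : Prop :=
  σ.IsIrreducible ∧
    (∃ φ : Representation.IntertwiningMap σ (kfBar K F M).toRepresentation, φ ≠ 0) ∧
    Nonempty (τ.Equiv (multRep K σ F).dual)

end Morphing

end Representations

/-! ### The additive category generated by finitely many modules -/

section Modules

variable {R : Type u} [Ring R] {n : ℕ}

/-- `⟨M₁, …, Mₙ⟩`: the full subcategory of `R`-modules isomorphic to `⨁ᵢ Mᵢ ^ bᵢ` for some
natural numbers `bᵢ`. -/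
abbrev AddGen (Mi : Fin n → ModuleCat.{v} R) : Type _ :=
  ObjectProperty.FullSubcategory
    (fun N : ModuleCat.{v} R => ∃ b : Fin n → ℕ, Nonempty (N ≃ₗ[R] ∀ i, Fin (b i) → Mi i))

instance finite_addGen_hom (Mi : Fin n → ModuleCat.{v} R) [∀ i, Finite (Mi i)]
    (X Y : AddGen Mi) : Finite (X ⟶ Y) := by
  obtain ⟨b, ⟨e⟩⟩ := X.property
  obtain ⟨c, ⟨d⟩⟩ := Y.property
  have : Finite X.obj := Finite.of_equiv _ e.symm.toEquiv
  have : Finite Y.obj := Finite.of_equiv _ d.symm.toEquiv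
  refine Finite.of_injective (fun f : X ⟶ Y => (f.hom : X.obj → Y.obj)) fun f g h => ?_
  ext x
  exact congrFun h x

/-- `X` is (isomorphic to) a direct summand of `M`. -/
def IsDirectSummand (X M : ModuleCat.{v} R) : Prop :=
  ∃ Z : ModuleCat.{v} R, Nonempty (M ≃ₗ[R] X × Z)

end Modules

end FunctorMorphing

/-! For `x ∈ F(M)`, the elements `F(g)(x)` form the subfunctor `G_x` of `F` that is the image of the
Yoneda map `Hom(M, -) ⟶ F` attached to `x`. If `G_x ≅ F`, then `G_x = F` because the values are
finite, so `Hom(M, -) ⟶ F` is epi. It factors through the projective cover `p : Hom(X, -) ⟶ F` by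
some `s^*` with `s : X ⟶ M`. Since `p` is essential, `s^*` is epi, and a preimage of `𝟙 X` is a
retraction of `s`, so `X` is a direct summand of `M` (`exists_retract`). Under the hypothesis on
`X`, therefore, `G_x ≺ F` for every `x`.

The spaces `KG_x(M)` detect all of `KF(M)`: restriction of coefficients `KF(M) ⟶ KG_x(M)` reads off
the coefficient at `x`, which forces `\overline{KF(M)} = 0`, and the image of the inclusion `KG_x(M)
⟶ KF(M)` contains `u_x`, which kills every map `KF(M) ⟶ V` in the first consequence. -/

namespace FunctorMorphing

/-! ### Subfunctors generated by one element, and retracts from projective covers. -/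

section GeneratedSubfunctor

variable {C : Type u} [Category.{v} C] [Preadditive C]

/-- The subgroup of `F(N)` of all `F(g)(x)` with `g : M ⟶ N`. -/
def generatedSubgroup (F : FinFun C) {M : C} (x : F.obj.obj M) (N : C) :
    AddSubgroup (F.obj.obj N) where
  carrier := {y | ∃ g : M ⟶ N, F.obj.map g x = y}
  zero_mem' := by
    have := F.property.1
    exact ⟨0, by rw [F.obj.map_zero]; rfl⟩
  add_mem' := by
    have := F.property.1
    rintro _ _ ⟨g, rfl⟩ ⟨h, rfl⟩
    exact ⟨g + h, by rw [F.obj.map_add]; rfl⟩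
  neg_mem' := by
    have := F.property.1
    rintro _ ⟨g, rfl⟩
    exact ⟨-g, by rw [F.obj.map_neg]; rfl⟩

theorem mem_generatedSubgroup_self (F : FinFun C) {M : C} (x : F.obj.obj M) :
    x ∈ generatedSubgroup F x M :=
  ⟨𝟙 M, by simp⟩

theorem map_mem_generatedSubgroup (F : FinFun C) {M : C} (x : F.obj.obj M) {N N' : C}
    (k : N ⟶ N') {y : F.obj.obj N} (hy : y ∈ generatedSubgroup F x N) :
    F.obj.map k y ∈ generatedSubgroup F x N' := by
  obtain ⟨g, rfl⟩ := hy
  exact ⟨g ≫ k, by simp⟩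

/-- The subfunctor of `F` generated by an element `x` of `F(M)`. -/
def generatedSubfunctor (F : FinFun C) {M : C} (x : F.obj.obj M) : FinFun C where
  obj :=
    { obj := fun N => AddCommGrpCat.of (generatedSubgroup F x N)
      map := fun {N N'} k => AddCommGrpCat.ofHom
        (((F.obj.map k).hom.comp (generatedSubgroup F x N).subtype).codRestrict
          (generatedSubgroup F x N') fun y => map_mem_generatedSubgroup F x k y.2)
      map_id := fun N => by
        refine AddCommGrpCat.hom_ext (AddMonoidHom.ext fun y => Subtype.ext ?_)
        exact congrArg (fun k => k.hom y.1) (F.obj.map_id N)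
      map_comp := fun k l => by
        refine AddCommGrpCat.hom_ext (AddMonoidHom.ext fun y => Subtype.ext ?_)
        exact congrArg (fun k => k.hom y.1) (F.obj.map_comp k l) }
  property := by
    have := F.property.1
    refine ⟨⟨fun {N N' k l} => ?_⟩, fun N => ?_⟩
    · refine AddCommGrpCat.hom_ext (AddMonoidHom.ext fun y => Subtype.ext ?_)
      exact congrArg (fun k => k.hom y.1) (F.obj.map_add (f := k) (g := l))
    · have := F.property.2 N
      exact inferInstanceAs (Finite (generatedSubgroup F x N))

/-- The inclusion into `F` of the subfunctor generated by an element. -/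
def generatedSubfunctorι (F : FinFun C) {M : C} (x : F.obj.obj M) :
    generatedSubfunctor F x ⟶ F :=
  ObjectProperty.homMk
    { app := fun N => AddCommGrpCat.ofHom (generatedSubgroup F x N).subtype
      naturality := fun _ _ _ => rfl }

theorem subquot_generatedSubfunctor (F : FinFun C) {M : C} (x : F.obj.obj M) :
    Subquot (generatedSubfunctor F x) F :=
  ⟨_, generatedSubfunctorι F x, 𝟙 _, fun _ => Subtype.val_injective, fun _ y => ⟨y, rfl⟩⟩

/-- A subfunctor generated by an element and isomorphic to `F` is all of `F`, by finiteness. -/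
theorem generatedSubgroup_eq_top_of_iso (F : FinFun C) {M : C} (x : F.obj.obj M)
    (e : generatedSubfunctor F x ≅ F) (N : C) : generatedSubgroup F x N = ⊤ := by
  have := F.property.2 N
  let e' : (generatedSubfunctor F x).obj.obj N ≅ F.obj.obj N :=
    ((ObjectProperty.ι _).mapIso e).app N
  exact AddSubgroup.eq_top_of_card_eq _ (Nat.card_congr e'.addCommGroupIsoToAddEquiv.toEquiv)

variable [∀ X Y : C, Finite (X ⟶ Y)]

/-- If an element of `F(M)` generates `F`, then `X` is a retract of `M` for every minimal
presentation `X ⟶ Y` of `F`. -/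
theorem IsMinimalPresentation.exists_retract {X Y M : C} {f : X ⟶ Y} {F : FinFun C}
    (hF : IsMinimalPresentation f F) (x : F.obj.obj M)
    (hx : ∀ N, generatedSubgroup F x N = ⊤) : ∃ (s : X ⟶ M) (r : M ⟶ X), s ≫ r = 𝟙 X := by
  obtain ⟨p, hp, -, hess, -⟩ := hF
  obtain ⟨s, hs⟩ := hp M x
  -- By naturality this composite sends `g : M ⟶ N` to `F(g)(p(s)) = F(g)(x)`, and such elements
  -- exhaust `F(N)`.
  have hsurj : IsSurj (homFunMap s ≫ p) := fun N y => by
    obtain ⟨g, rfl⟩ : y ∈ generatedSubgroup F x N := hx N ▸ AddSubgroup.mem_top y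
    refine ⟨g, ?_⟩
    rw [← hs]
    exact congrArg (fun k => k.hom s) (p.hom.naturality g)
  -- Essentiality of `p` makes precomposition with `s` surjective; at `X` it hits the identity.
  obtain ⟨r, hr⟩ := hess _ _ hsurj X (𝟙 X)
  exact ⟨s, r, hr⟩

theorem IsMinimalPresentation.strictSubquot_generatedSubfunctor {X Y M : C} {f : X ⟶ Y}
    {F : FinFun C} (hF : IsMinimalPresentation f F)
    (hX : ¬ ∃ (s : X ⟶ M) (r : M ⟶ X), s ≫ r = 𝟙 X) (x : F.obj.obj M) :
    StrictSubquot (generatedSubfunctor F x) F :=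
  ⟨subquot_generatedSubfunctor F x, fun ⟨e⟩ =>
    hX (hF.exists_retract x (generatedSubgroup_eq_top_of_iso F x e))⟩

end GeneratedSubfunctor

/-! ### Vanishing of the permutation representations. -/

section Representations

variable (K : Type w) [Field K] {C : Type u} [Category.{v} C] [Preadditive C]

/-- A monomorphism `t : G ⟶ F` induces a homomorphism `KF(M) ⟶ KG(M)` that restricts
coefficients along `t_M`. -/
noncomputable def kfRestrict {G F : FinFun C} (t : G ⟶ F) (ht : IsInj t) (M : C) :
    Representation.IntertwiningMap (KF K F M) (KF K G M) where
  toLinearMap := Finsupp.lcomapDomain (t.hom.app M) (ht M)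
  isIntertwining' g := by
    ext a y
    have hnat (z : G.obj.obj M) : t.hom.app M (G.obj.map g.hom z) =
        F.obj.map g.hom (t.hom.app M z) :=
      congrArg (fun k => k.hom z) (t.hom.naturality g.hom)
    have hinj (L : FinFun C) : Function.Injective (L.obj.map g.hom) :=
      (L.obj.mapIso g).addCommGroupIsoToAddEquiv.injective
    -- Writing the evaluation point as a translate by `g` lets `Finsupp.mapDomain_apply` compute
    -- both sides, since `g` acts injectively.
    obtain ⟨z, rfl⟩ : ∃ z, G.obj.map g.hom z = y :=
      (G.obj.mapIso g).addCommGroupIsoToAddEquiv.surjective y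
    change Finsupp.mapDomain (F.obj.map g.hom) (Finsupp.single a 1)
        (t.hom.app M (G.obj.map g.hom z)) =
      Finsupp.mapDomain (G.obj.map g.hom)
        (Finsupp.comapDomain (t.hom.app M) (Finsupp.single a 1) (ht M).injOn) (G.obj.map g.hom z)
    rw [hnat, Finsupp.mapDomain_apply (hinj F), Finsupp.mapDomain_apply (hinj G),
      Finsupp.comapDomain_apply]

variable {K}

/-- Each restriction map to `KG_x(M)` vanishes on `\overline{KF(M)}`, so an element of the latter
has zero coefficient at every `x`. -/
theorem kfBar_eq_bot {F : FinFun C} {M : C}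
    (h : ∀ x : F.obj.obj M, StrictSubquot (generatedSubfunctor F x) F) : kfBar K F M = ⊥ := by
  refine eq_bot_iff.2 fun y hy => ?_
  refine (Submodule.mem_bot K).2 (Finsupp.ext fun x => ?_)
  let r := kfRestrict K (generatedSubfunctorι F x) (fun _ => Subtype.val_injective) M
  let φ : Representation.IntertwiningMap (kfBar K F M).toRepresentation
      (KF K (generatedSubfunctor F x) M) :=
    { toLinearMap := r.toLinearMap ∘ₗ (kfBar K F M).toSubmodule.subtype
      isIntertwining' := fun g => by
        ext1 z
        exact LinearMap.congr_fun (r.isIntertwining' g) z.1 }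
  have hφ : φ ⟨y, hy⟩ = 0 := by rw [killedBelow_kfBar K F M _ (h x) φ]; rfl
  exact DFunLike.congr_fun hφ ⟨x, mem_generatedSubgroup_self F x⟩

/-- Here extension by zero `KG_x(M) ⟶ KF(M)` replaces restriction: a map out of `KF(M)` that dies on
each of these images dies on each basis vector `u_x`. -/
theorem not_isMorphingFunctor {F : FinFun C} {M : C}
    (h : ∀ x : F.obj.obj M, StrictSubquot (generatedSubfunctor F x) F)
    {V : Type*} [AddCommGroup V] [Module K V] (σ : Representation K (Aut M) V) :
    ¬ IsMorphingFunctor K σ F := by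
  rintro ⟨⟨φ, hφ⟩, hG⟩
  apply hφ
  ext x
  let ψ : Representation.IntertwiningMap (KF K (generatedSubfunctor F x) M) σ :=
    φ.comp (kfMap K (generatedSubfunctorι F x) M)
  have hψ : ψ (Finsupp.single ⟨x, mem_generatedSubgroup_self F x⟩ 1) = 0 := by
    rw [hG _ (h x) ψ]; rfl
  have hx : kfMap K (generatedSubfunctorι F x) M
      (Finsupp.single ⟨x, mem_generatedSubgroup_self F x⟩ 1) = Finsupp.single x 1 :=
    Finsupp.mapDomain_single
  exact (congrArg φ hx).symm.trans hψ

theorem not_isFunctorMorphing {F : FinFun C} {M : C} (h : kfBar K F M = ⊥)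
    {V : Type*} [AddCommGroup V] [Module K V] (σ : Representation K (Aut M) V)
    {U : Type*} [AddCommGroup U] [Module K U] (τ : Representation K (Aut F) U) :
    ¬ IsFunctorMorphing K σ F τ := by
  rintro ⟨-, ⟨φ, hφ⟩, -⟩
  apply hφ
  ext1
  ext1 y
  have hy : (φ y).1 ∈ (⊥ : Subrepresentation (KF K F M)) := h ▸ (φ y).2
  exact Subtype.ext ((Submodule.mem_bot K).1 hy)

end Representations

/-- The idempotent `s ∘ r` splits `M`, with complement `ker r`. That complement need only be an
`R`-module, not an object of `AddGen Mi`. -/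
theorem isDirectSummand_of_retract {R : Type u} [Ring R] {X M : ModuleCat.{v} R}
    (s : X ⟶ M) (r : M ⟶ X) (h : s ≫ r = 𝟙 X) : IsDirectSummand X M := by
  have hrs (x : X) : r.hom (s.hom x) = x := congrArg (fun k => k.hom x) h
  exact ⟨ModuleCat.of R (LinearMap.ker r.hom), ⟨{
    toFun := fun m => (r.hom m, ⟨m - s.hom (r.hom m), by simp [hrs]⟩)
    map_add' := fun a b => Prod.ext (by simp) (Subtype.ext (by simp; abel))
    map_smul' := fun c a => Prod.ext (by simp) (Subtype.ext (by simp [smul_sub]))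
    invFun := fun q => s.hom q.1 + q.2.1
    left_inv := fun m => by simp
    right_inv := fun ⟨x, k, hk⟩ => by
      have hk' : r.hom k = 0 := hk
      exact Prod.ext (by simp [hrs, hk']) (Subtype.ext (by simp [hrs, hk'])) }⟩⟩

end FunctorMorphing

theorem mainTheorem6 {K : Type w} [Field K] [CharZero K]
    {R : Type u} [Ring R] [Finite R] {n : ℕ}
    (Mi : Fin n → ModuleCat.{v} R) [∀ i, Finite (Mi i)]
    (hind : ∀ i, Indecomposable (Mi i))
    (hiso : ∀ i j, i ≠ j → ¬ Nonempty (Mi i ≅ Mi j))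
    (M X Y : FunctorMorphing.AddGen Mi) (f : X ⟶ Y) (F : FunctorMorphing.FinFun (FunctorMorphing.AddGen Mi))
    (hF : FunctorMorphing.IsMinimalPresentation f F)
    (hX : ¬ FunctorMorphing.IsDirectSummand X.obj M.obj) :
    FunctorMorphing.kfBar K F M = ⊥ ∧
    (∀ {V : Type*} [AddCommGroup V] [Module K V] (σ : Representation K (Aut M) V),
      σ.IsIrreducible → ¬ FunctorMorphing.IsMorphingFunctor K σ F) ∧
    (∀ {V : Type*} [AddCommGroup V] [Module K V] (σ : Representation K (Aut M) V)
      {U : Type*} [AddCommGroup U] [Module K U] (τ : Representation K (Aut F) U),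
      ¬ FunctorMorphing.IsFunctorMorphing K σ F τ) := by
  have hstrict (x : F.obj.obj M) :=
    hF.strictSubquot_generatedSubfunctor (M := M) (fun ⟨s, r, hsr⟩ =>
      hX (FunctorMorphing.isDirectSummand_of_retract s.hom r.hom
        (congrArg (fun k => k.hom) hsr))) x
  have hbar := FunctorMorphing.kfBar_eq_bot (K := K) hstrict
  exact ⟨hbar, fun σ _ => FunctorMorphing.not_isMorphingFunctor hstrict σ,
    fun σ _ _ _ τ => FunctorMorphing.not_isFunctorMorphing hbar σ τ⟩
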